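/- Let $n\ge 0$ and let $\sigma$ be a permutation of $[n]=\{1,\dots,n\}$. Let $P_\sigma$ be the poset of pairs $(i,\sigma(i))$, $i\in[n]$, with $(i,\sigma(i))\le(j,\sigma(j))$ if and only if $i\le j$ and $\sigma(i)\le\sigma(j)$. For $k\ge 0$ let $c_k$ (resp. $a_k$) be the maximal cardinality of a union of $k$ chains (resp. $k$ antichains) of $P_\sigma$. Let $P(\sigma)$ and $Q(\sigma)$ be the insertion tableau and the recording tableau computed by Schensted's algorithm: start with two empty tableaux and, for $i=1,\dots,n$, row-insert $\sigma(i)$ into the first one and add a box with entry $i$ to the second one at the position of the newly created box. Here, to row-insert $x$, replace by $x$ the leftmost entry of the first row that is greater than $x$ and insert the replaced entry into the next row in the same way, and so on; if a row has no entry greater than the element being inserted, then that element is appended at the end of the row and the insertion stops. Then $P(\sigma)$ and $Q(\sigma)$ have the same shape, and this common shape is $\lambda(P_\sigma)$, the Young diagram whose row lengths are $c_k-c_{k-1}$ and whose column lengths are $a_k-a_{k-1}$ for $k=1,2,\dots$. -/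

import Mathlib

namespace RobinsonSchensted

/-! ## The shape of a finite poset -/

/-- The cardinalities of the unions of `k` chains of `P` (chains may be empty or overlap). -/
def chainUnionSizes (P : Type*) [PartialOrder P] (k : ℕ) : Set ℕ :=
  {m | ∃ C : Fin k → Set P, (∀ t, IsChain (· ≤ ·) (C t)) ∧ (⋃ t, C t).ncard = m}

/-- The cardinalities of the unions of `k` antichains of `P`. -/
def antichainUnionSizes (P : Type*) [PartialOrder P] (k : ℕ) : Set ℕ :=
  {m | ∃ A : Fin k → Set P, (∀ t, IsAntichain (· ≤ ·) (A t)) ∧ (⋃ t, A t).ncard = m}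

/-- `c_k`: the maximal cardinality of a union of `k` chains of the finite poset `P`. -/
noncomputable def maxChainUnion (P : Type*) [PartialOrder P] (k : ℕ) : ℕ :=
  sSup (chainUnionSizes P k)

/-- `a_k`: the maximal cardinality of a union of `k` antichains of the finite poset `P`. -/
noncomputable def maxAntichainUnion (P : Type*) [PartialOrder P] (k : ℕ) : ℕ :=
  sSup (antichainUnionSizes P k)

/-- For a finite poset the supremum defining `c_k` is an attained maximum. -/
theorem isGreatest_maxChainUnion (P : Type*) [PartialOrder P] [Finite P] (k : ℕ) :
    IsGreatest (chainUnionSizes P k) (maxChainUnion P k) := by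
  have hb : BddAbove (chainUnionSizes P k) :=
    ⟨Nat.card P, by rintro m ⟨C, -, rfl⟩; exact Set.ncard_le_card _⟩
  have hne : (chainUnionSizes P k).Nonempty :=
    ⟨_, fun _ => ∅, fun _ => by simp [IsChain], rfl⟩
  exact ⟨Nat.sSup_mem hne hb, fun m hm => le_csSup hb hm⟩

/-- For a finite poset the supremum defining `a_k` is an attained maximum. -/
theorem isGreatest_maxAntichainUnion (P : Type*) [PartialOrder P] [Finite P] (k : ℕ) :
    IsGreatest (antichainUnionSizes P k) (maxAntichainUnion P k) := by
  have hb : BddAbove (antichainUnionSizes P k) :=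
    ⟨Nat.card P, by rintro m ⟨C, -, rfl⟩; exact Set.ncard_le_card _⟩
  have hne : (antichainUnionSizes P k).Nonempty :=
    ⟨_, fun _ => ∅, fun _ => by simp [IsAntichain], rfl⟩
  exact ⟨Nat.sSup_mem hne hb, fun m hm => le_csSup hb hm⟩

/-- `μ = λ(P)`: the row lengths of `μ` are the differences `c_{k+1} - c_k` and its column lengths
are the differences `a_{k+1} - a_k`, for `k = 0, 1, 2, …` (rows and columns of a `YoungDiagram` are
numbered from `0`). The row lengths alone determine `μ`. -/
def IsPosetShape (P : Type*) [PartialOrder P] (μ : YoungDiagram) : Prop :=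
  (∀ k, maxChainUnion P (k + 1) = maxChainUnion P k + μ.rowLen k) ∧
  (∀ k, maxAntichainUnion P (k + 1) = maxAntichainUnion P k + μ.colLen k)

/-! ## The permutation poset -/

/-- The permutation poset `P_σ`: the set of pairs `(i, σ i)`, ordered as a subset of the product of
two chains. -/
abbrev PermPoset {n : ℕ} (σ : Equiv.Perm (Fin n)) : Type :=
  {p : Fin n × Fin n // p.2 = σ p.1}

/-! ## Schensted's insertion algorithm -/

/-- A filling by elements of `α`, given as the list of its rows from top to bottom, each row
listed from left to right. -/
abbrev Filling (α : Type*) := List (List α)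

/-- Row insertion of `x`: `x` replaces the leftmost entry greater than `x`, which is returned as the
bumped entry; if there is no such entry then `x` is appended at the end and nothing is bumped. -/
def rowInsert {α : Type*} [LinearOrder α] (x : α) : List α → List α × Option α
  | [] => ([x], none)
  | y :: r => if x < y then (x :: r, some y) else (y :: (rowInsert x r).1, (rowInsert x r).2)

/-- Schensted insertion of `x` into a tableau: `x` is inserted into the first row, an entry bumped
from a row is inserted into the next one, until nothing is bumped. Returned together with the new
tableau is the index (from `0`) of the row in which the new box was created. -/
def schenstedInsert {α : Type*} [LinearOrder α] : α → Filling α → Filling α × ℕ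
  | x, [] => ([[x]], 0)
  | x, r :: T =>
    match rowInsert x r with
    | (r', none) => (r' :: T, 0)
    | (r', some y) => (r' :: (schenstedInsert y T).1, (schenstedInsert y T).2 + 1)

/-- Add a box with entry `a` at the end of the row with index `k` (a new last row if there are only
`k` rows). -/
def addBox {α : Type*} (a : α) : ℕ → Filling α → Filling α
  | _, [] => [[a]]
  | 0, r :: T => (r ++ [a]) :: T
  | k + 1, r :: T => r :: addBox a k T

/-- One step of the algorithm on a pair (insertion tableau, recording tableau): insert `σ i` in the
first one, and record `i` in the second one at the place of the new box. -/
def rsStep {n : ℕ} (σ : Equiv.Perm (Fin n)) (s : Filling (Fin n) × Filling (Fin n)) (i : Fin n) :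
    Filling (Fin n) × Filling (Fin n) :=
  ((schenstedInsert (σ i) s.1).1, addBox i (schenstedInsert (σ i) s.1).2 s.2)

/-- The pair `(P(σ), Q(σ))`, obtained from the pair of empty tableaux by performing the steps for
`σ 0, σ 1, …, σ (n - 1)` in this order. The chain `Fin n` plays the role of `[n]`. -/
def robinsonSchensted {n : ℕ} (σ : Equiv.Perm (Fin n)) : Filling (Fin n) × Filling (Fin n) :=
  (List.finRange n).foldl (rsStep σ) ([], [])

/-- The insertion tableau `P(σ)`. -/
def insertionTableau {n : ℕ} (σ : Equiv.Perm (Fin n)) : Filling (Fin n) :=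
  (robinsonSchensted σ).1

/-- The recording tableau `Q(σ)`. -/
def recordingTableau {n : ℕ} (σ : Equiv.Perm (Fin n)) : Filling (Fin n) :=
  (robinsonSchensted σ).2

/-- The filling `T` has shape `μ`: its row lengths, from top to bottom, are the (nonzero) row
lengths of the Young diagram `μ`. -/
def HasShape {α : Type*} (T : Filling α) (μ : YoungDiagram) : Prop :=
  T.map List.length = μ.rowLens

end RobinsonSchensted

/-! The argument is by duality. A chain and an antichain share at most one element, so c_k + a_l ≤ n
+ kl. Let μ be the shape of P(σ). If the first k rows and the first l columns of μ cover it and meet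
in a full k × l rectangle, their sizes add up to exactly n + kl. For each k this happens with l =
`μ.rowLen k`, and for each l with k = `μ.colLen l`. So it suffices to bound c_k from below by the
first k rows and a_l by the first l columns: both bounds are then equalities.

For the lower bounds, increasing subwords of the word of σ are chains, and those of the reversed
word are antichains. In the reading word of P(σ) the rows are increasing subwords, and so are the
columns in its reverse. Knuth moves lead from the reading word to the word of σ (`insertWord_spec`),
and every move keeps a cover by k increasing subwords, both of the word and of its reverse
(`swap_descent`, `swap_ascent`). Only this direction is needed, since the upper bounds come from
duality.

Q(σ) has the same shape because both tableaux gain the same box at each step. -/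

namespace RobinsonSchensted

open Relation

variable {α : Type*} [LinearOrder α]

/-! ## Coloured words and Knuth moves -/

/-- The letters of the word `w` can be coloured in such a way that, for each colour less than `k`,
the letters of this colour form an increasing subword, and at least `m` letters have a colour less
than `k`. -/
def HasIncreasingCover (k m : ℕ) (w : List α) : Prop :=
  ∃ d : List (α × ℕ), d.map Prod.fst = w ∧
    d.Pairwise (fun p q => p.2 = q.2 → p.2 < k → p.1 < q.1) ∧ m ≤ d.countP (fun p => p.2 < k)

/-- The Knuth moves in the direction leading from the reading word of a tableau after an insertion
to the reading word before the insertion followed by the inserted letter. -/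
inductive KnuthMove : List α → List α → Prop
  | left (u v : List α) {a x y : α} (hax : a < x) (hxy : x < y) :
      KnuthMove (u ++ y :: a :: x :: v) (u ++ a :: y :: x :: v)
  | right (u v : List α) {x y b : α} (hxy : x < y) (hyb : y < b) :
      KnuthMove (u ++ y :: x :: b :: v) (u ++ y :: b :: x :: v)

/-- The colours are kept: only the order of `x` and `z` changes, and the new order is increasing. -/
theorem HasIncreasingCover.swap_descent {k m : ℕ} {u v : List α} {x z : α} (hxz : x < z)
    (h : HasIncreasingCover k m (u ++ z :: x :: v)) :
    HasIncreasingCover k m (u ++ x :: z :: v) := by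
  obtain ⟨d, hd, hp, hm⟩ := h
  obtain ⟨du, d', rfl, rfl, hd'⟩ := List.map_eq_append_iff.1 hd
  obtain ⟨⟨z, cz⟩, d', rfl, rfl, hd₁⟩ := List.map_eq_cons_iff.1 hd'
  obtain ⟨⟨x, cx⟩, dv, rfl, rfl, rfl⟩ := List.map_eq_cons_iff.1 hd₁
  refine ⟨du ++ (x, cx) :: (z, cz) :: dv, by simp, ?_, ?_⟩
  · simp only [List.pairwise_append, List.pairwise_cons, List.mem_cons] at hp ⊢
    obtain ⟨h1, ⟨h2, h3, h4⟩, h5⟩ := hp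
    refine ⟨h1, ⟨?_, fun q hq => h2 q (Or.inr hq), h4⟩, ?_⟩
    · rintro q (rfl | hq)
      · exact fun _ _ => hxz
      · exact h3 q hq
    · rintro p hp q (rfl | rfl | hq)
      · exact h5 p hp _ (by simp)
      · exact h5 p hp _ (by simp)
      · exact h5 p hp _ (by simp [hq])
  · refine hm.trans_eq ?_
    simp only [List.countP_append, List.countP_cons]
    ring

/-- The swap does harm only if `x` and `z` share a colour less than `k`. Then `y`, which precedes
`x` and is greater, has another colour and can stand before `z` in place of `x`. -/
theorem HasIncreasingCover.swap_ascent {k m : ℕ} {u v : List α} {x y z : α}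
    (hxy : x < y) (hyz : y < z) (h : HasIncreasingCover k m (u ++ y :: x :: z :: v)) :
    HasIncreasingCover k m (u ++ y :: z :: x :: v) := by
  obtain ⟨d, hd, hp, hm⟩ := h
  obtain ⟨du, d', rfl, rfl, hd'⟩ := List.map_eq_append_iff.1 hd
  obtain ⟨⟨y, t⟩, d', rfl, rfl, hd₁⟩ := List.map_eq_cons_iff.1 hd'
  obtain ⟨⟨x, s⟩, d', rfl, rfl, hd₂⟩ := List.map_eq_cons_iff.1 hd₁
  obtain ⟨⟨z, r⟩, dv, rfl, rfl, rfl⟩ := List.map_eq_cons_iff.1 hd₂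
  simp only [List.pairwise_append, List.pairwise_cons, List.mem_cons, forall_eq_or_imp] at hp
  simp only at hxy hyz
  obtain ⟨hu, ⟨⟨hyx, -, hyv⟩, ⟨hxz, hxv⟩, hzv, hv⟩, huw⟩ := hp
  by_cases hrs : r = s ∧ s < k
  · obtain ⟨rfl, hrk⟩ := hrs
    have htr : t ≠ r := fun h => (hxy.trans (hyx h (h ▸ hrk))).false
    by_cases htk : t < k
    · -- exchange the continuations of the two increasing subwords
      let f : α × ℕ → α × ℕ := fun p => (p.1, Equiv.swap t r p.2)
      have hf : ∀ c, Equiv.swap t r c < k ↔ c < k := by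
        intro c
        rw [Equiv.swap_apply_def]
        split_ifs <;> omega
      refine ⟨du ++ (y, t) :: (z, t) :: (x, r) :: dv.map f, by simp [f, Function.comp_def], ?_, ?_⟩
      · simp only [List.pairwise_append, List.pairwise_cons, List.mem_cons, forall_eq_or_imp,
          List.pairwise_map, List.forall_mem_map, f, hf, EmbeddingLike.apply_eq_iff_eq]
        have key : ∀ c c', c = Equiv.swap t r c' ↔ Equiv.swap t r c = c' := by
          intro c c'
          rw [← Equiv.swap_apply_eq_iff]
        simp only [key, Equiv.swap_apply_left, Equiv.swap_apply_right]
        refine ⟨hu, ⟨⟨fun _ _ => hyz, fun h => (htr h).elim,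
          fun q hq h _ => hyz.trans (hzv q hq h hrk)⟩,
          ⟨fun h => (htr h).elim, fun q hq h _ => hzv q hq h hrk⟩,
          fun q hq h _ => hxy.trans (hyv q hq h htk), hv⟩, ?_⟩
        intro p hp
        obtain ⟨h1, h2, h3, h4⟩ := huw p hp
        refine ⟨h1, fun h h' => (h1 h h').trans hyz, h2, fun q hq h h' => ?_⟩
        -- Colour `t` now runs through `y`, `z` into the former tail of colour `r`; colour `r` runs
        -- through `x` into the former tail of `t`, where `x < y` is below every letter.
        by_cases hpt : p.2 = t
        · rw [hpt, Equiv.swap_apply_left] at h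
          exact ((h1 hpt h').trans hyz).trans (hzv q hq h hrk)
        by_cases hpr : p.2 = r
        · rw [hpr, Equiv.swap_apply_right] at h
          exact ((h2 hpr h').trans hxy).trans (hyv q hq h htk)
        rw [Equiv.swap_apply_of_ne_of_ne hpt hpr] at h
        exact h4 q hq h h'
      · refine hm.trans_eq ?_
        simp [List.countP_append, List.countP_map, Function.comp_def, f, hf,
          hrk, htk]
    · -- `y` is not coloured: it takes the place of `x`
      refine ⟨du ++ (y, r) :: (z, r) :: (x, t) :: dv, by simp, ?_, ?_⟩
      · simp only [List.pairwise_append, List.pairwise_cons, List.mem_cons, forall_eq_or_imp]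
        refine ⟨hu, ⟨⟨fun _ _ => hyz, fun h => (htr h.symm).elim,
          fun q hq h h' => hyz.trans (hzv q hq h h')⟩,
          ⟨fun h => (htr h.symm).elim, hzv⟩, fun q hq h h' => (htk h').elim, hv⟩, ?_⟩
        intro p hp
        obtain ⟨h1, h2, h3, h4⟩ := huw p hp
        exact ⟨fun h h' => (h2 h h').trans hxy, h3, fun h h' => (htk (h ▸ h')).elim, h4⟩
      · refine hm.trans_eq ?_
        simp [List.countP_append, hrk, htk]
  · refine ⟨du ++ (y, t) :: (z, r) :: (x, s) :: dv, by simp, ?_, ?_⟩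
    · simp only [List.pairwise_append, List.pairwise_cons, List.mem_cons, forall_eq_or_imp]
      refine ⟨hu, ⟨⟨fun _ _ => hyz, hyx, hyv⟩,
        ⟨fun h h' => (hrs ⟨h, h ▸ h'⟩).elim, hzv⟩, hxv, hv⟩, ?_⟩
      intro p hp
      obtain ⟨h1, h2, h3, h4⟩ := huw p hp
      exact ⟨h1, h3, h2, h4⟩
    · refine hm.trans_eq ?_
      simp only [List.countP_append, List.countP_cons]
      ring

theorem HasIncreasingCover.of_knuthMove {k m : ℕ} {w w' : List α} (h : KnuthMove w w')
    (hw : HasIncreasingCover k m w) : HasIncreasingCover k m w' := by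
  cases h with
  | left u v hax hxy => exact hw.swap_descent (hax.trans hxy)
  | right u v hxy hyb => exact hw.swap_ascent hxy hyb

/-- Under reversal the two kinds of moves exchange roles: a left move becomes an ascent swap, a
right move a descent swap. -/
theorem HasIncreasingCover.reverse_of_knuthMove {k m : ℕ} {w w' : List α} (h : KnuthMove w w')
    (hw : HasIncreasingCover k m w.reverse) : HasIncreasingCover k m w'.reverse := by
  cases h with
  | left u v hax hxy =>
    simp only [List.reverse_append, List.reverse_cons, List.append_assoc, List.cons_append,
      List.nil_append] at hw ⊢
    exact hw.swap_ascent hax hxy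
  | @right u v x y b hxy hyb =>
    simp only [List.reverse_append, List.reverse_cons, List.append_assoc, List.cons_append,
      List.nil_append] at hw ⊢
    exact hw.swap_descent (hxy.trans hyb)

theorem HasIncreasingCover.of_knuthMoves {k m : ℕ} {w w' : List α}
    (h : ReflTransGen KnuthMove w w') (hw : HasIncreasingCover k m w) :
    HasIncreasingCover k m w' := by
  induction h with
  | refl => exact hw
  | tail _ h ih => exact ih.of_knuthMove h

theorem HasIncreasingCover.reverse_of_knuthMoves {k m : ℕ} {w w' : List α}
    (h : ReflTransGen KnuthMove w w') (hw : HasIncreasingCover k m w.reverse) :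
    HasIncreasingCover k m w'.reverse := by
  induction h with
  | refl => exact hw
  | tail _ h ih => exact ih.reverse_of_knuthMove h

theorem KnuthMove.append_append {w w' : List α} (h : KnuthMove w w') (u v : List α) :
    KnuthMove (u ++ w ++ v) (u ++ w' ++ v) := by
  cases h with
  | left u' v' hax hxy => simpa using KnuthMove.left (u ++ u') (v' ++ v) hax hxy
  | right u' v' hxy hyb => simpa using KnuthMove.right (u ++ u') (v' ++ v) hxy hyb

theorem knuthMoves_append_append {w w' : List α} (h : ReflTransGen KnuthMove w w')
    (u v : List α) : ReflTransGen KnuthMove (u ++ w ++ v) (u ++ w' ++ v) :=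
  h.lift _ fun _ _ h => h.append_append u v

/-! ## Row insertion -/

theorem rowInsert_perm (x : α) (r : List α) :
    ((rowInsert x r).2.toList ++ (rowInsert x r).1).Perm (x :: r) := by
  induction r with
  | nil => simp [rowInsert]
  | cons a r ih =>
    rw [rowInsert]
    split_ifs with h
    · exact List.Perm.swap _ _ _
    · exact List.perm_middle.trans ((ih.cons a).trans (List.Perm.swap _ _ _))

theorem mem_of_mem_rowInsert {x b : α} {r : List α} (h : b ∈ (rowInsert x r).1) :
    b = x ∨ b ∈ r := by
  simpa using (rowInsert_perm x r).subset (List.mem_append_right _ h)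

theorem rowInsert_snd_mem {x y : α} {r : List α} (h : (rowInsert x r).2 = some y) : y ∈ r := by
  induction r with
  | nil => simp [rowInsert] at h
  | cons a r ih =>
    rw [rowInsert] at h
    split_ifs at h with hxa
    · simp at h
      simp [h]
    · exact List.mem_cons_of_mem _ (ih h)

theorem rowInsert_pairwise {x : α} {r : List α} (hr : r.Pairwise (· < ·)) (hx : x ∉ r) :
    (rowInsert x r).1.Pairwise (· < ·) := by
  induction r with
  | nil => simp [rowInsert]
  | cons a r ih =>
    rw [List.pairwise_cons] at hr
    rw [List.mem_cons, not_or] at hx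
    rw [rowInsert]
    split_ifs with h
    · exact List.pairwise_cons.2 ⟨fun b hb => h.trans (hr.1 b hb), hr.2⟩
    · refine List.pairwise_cons.2 ⟨fun b hb => ?_, ih hr.2 hx.2⟩
      rcases mem_of_mem_rowInsert hb with rfl | hb
      · exact lt_of_le_of_ne (not_lt.1 h) (Ne.symm hx.1)
      · exact hr.1 b hb

theorem rowInsert_fst_of_snd_eq_none {x : α} {r : List α} (h : (rowInsert x r).2 = none) :
    (rowInsert x r).1 = r ++ [x] := by
  induction r with
  | nil => rfl
  | cons a r ih =>
    rw [rowInsert] at h ⊢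
    split_ifs at h ⊢ with hxa
    simp [ih h]

theorem exists_eq_of_rowInsert_snd_eq_some {x y : α} {r : List α}
    (h : (rowInsert x r).2 = some y) :
    ∃ A B, r = A ++ y :: B ∧ (rowInsert x r).1 = A ++ x :: B ∧ (∀ a ∈ A, a ≤ x) ∧ x < y := by
  induction r with
  | nil => simp [rowInsert] at h
  | cons a r ih =>
    rw [rowInsert] at h ⊢
    split_ifs at h ⊢ with hxa
    · obtain rfl : a = y := by simpa using h
      exact ⟨[], r, rfl, rfl, by simp, hxa⟩
    · obtain ⟨A, B, h1, h2, h3, h4⟩ := ih h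
      refine ⟨a :: A, B, by simp [h1], by simp [h2], ?_, h4⟩
      simpa using ⟨not_lt.1 hxa, h3⟩

/-- `y` jumps over the letters of `A` one at a time; the witness of each jump is the letter that
follows, the next one of `A` or finally `x`. -/
theorem knuthMoves_past_left {x y : α} (hxy : x < y) {A : List α} (hA : A.Pairwise (· < ·))
    (hAx : ∀ a ∈ A, a < x) : ReflTransGen KnuthMove (y :: (A ++ [x])) (A ++ [y, x]) := by
  induction A with
  | nil => exact .refl
  | cons a A ih =>
    rw [List.pairwise_cons] at hA
    rw [List.forall_mem_cons] at hAx
    have h1 : KnuthMove (y :: (a :: A ++ [x])) (a :: y :: (A ++ [x])) := by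
      cases A with
      | nil => exact KnuthMove.left [] [] hAx.1 hxy
      | cons b A =>
        exact KnuthMove.left [] (A ++ [x]) (hA.1 b (by simp)) ((hAx.2 b (by simp)).trans hxy)
    refine .head h1 ?_
    simpa using knuthMoves_append_append (ih hA.2 hAx.2) [a] []

/-- `x` jumps over the letters of `B`; the witness is the letter just before `x`, so after each jump
the letter passed takes the role of `y`. -/
theorem knuthMoves_past_right {x y : α} (hxy : x < y) {B : List α}
    (hB : (y :: B).Pairwise (· < ·)) :
    ReflTransGen KnuthMove (y :: x :: B) (y :: (B ++ [x])) := by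
  induction B generalizing y with
  | nil => exact .refl
  | cons b B ih =>
    rw [List.pairwise_cons] at hB
    have hyb := hB.1 b (by simp)
    refine .head (KnuthMove.right [] B hxy hyb) ?_
    simpa using knuthMoves_append_append (ih (hxy.trans hyb) hB.2) [y] []

/-- With r = A y B, the moves are y A x B → A y x B → A y B x. -/
theorem knuthMoves_rowInsert {x y : α} {r : List α} (hr : r.Pairwise (· < ·)) (hx : x ∉ r)
    (h : (rowInsert x r).2 = some y) :
    ReflTransGen KnuthMove (y :: (rowInsert x r).1) (r ++ [x]) := by
  obtain ⟨A, B, rfl, h2, h3, h4⟩ := exists_eq_of_rowInsert_snd_eq_some h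
  rw [h2]
  rw [List.pairwise_append] at hr
  have hA : ∀ a ∈ A, a < x := fun a ha =>
    lt_of_le_of_ne (h3 a ha) (by rintro rfl; simp [ha] at hx)
  have h5 := knuthMoves_append_append (knuthMoves_past_left h4 hr.1 hA) [] B
  have h6 := knuthMoves_append_append (knuthMoves_past_right h4 hr.2.1) A []
  simp only [List.nil_append, List.append_nil, List.append_assoc, List.cons_append] at h5 h6 ⊢
  exact h5.trans h6

/-! ## Tableaux -/

/-- The row `s` may stand below the row `r` in a tableau: it is not longer, and each of its entries
is greater than the entry of `r` in the same column. -/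
def RowAbove : List α → List α → Prop
  | _, [] => True
  | [], _ :: _ => False
  | a :: r, b :: s => a < b ∧ RowAbove r s

@[simp]
theorem rowAbove_nil (r : List α) : RowAbove r [] := by
  cases r <;> trivial

theorem RowAbove.length_le {r s : List α} (h : RowAbove r s) : s.length ≤ r.length := by
  induction r generalizing s with
  | nil => cases s <;> simp_all [RowAbove]
  | cons a r ih =>
    cases s with
    | nil => simp
    | cons b s => simpa using ih h.2

theorem RowAbove.getElem_lt {r s : List α} (h : RowAbove r s) {i : ℕ} {a b : α}
    (ha : r[i]? = some a) (hb : s[i]? = some b) : a < b := by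
  induction r generalizing s i with
  | nil => simp at ha
  | cons a' r ih =>
    cases s with
    | nil => simp at hb
    | cons b' s =>
      cases i with
      | zero =>
        simp only [List.getElem?_cons_zero, Option.some.injEq] at ha hb
        exact ha ▸ hb ▸ h.1
      | succ i => exact ih h.2 (by simpa using ha) (by simpa using hb)

theorem RowAbove.trans {r s t : List α} (h : RowAbove r s) (h' : RowAbove s t) :
    RowAbove r t := by
  induction r generalizing s t with
  | nil => cases s <;> cases t <;> simp_all [RowAbove]
  | cons a r ih =>
    cases s <;> cases t <;> simp only [RowAbove] at h h' ⊢
    exact ⟨h.1.trans h'.1, ih h.2 h'.2⟩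

theorem RowAbove.rowInsert_left {r s : List α} (h : RowAbove r s) (x : α) :
    RowAbove (rowInsert x r).1 s := by
  induction r generalizing s with
  | nil => cases s <;> simp_all [RowAbove]
  | cons a r ih =>
    cases s with
    | nil => simp
    | cons b s =>
      rw [rowInsert]
      split_ifs with hxa
      · exact ⟨hxa.trans h.1, h.2⟩
      · exact ⟨h.1, ih h.2⟩

/-- The entry below the old place of `y`, if any, exceeds `y`, so `y` lands in that column or
further left. Above it there is then `x` or an entry of `r` preceding `y`, both smaller than `y`. -/
theorem RowAbove.rowInsert_rowInsert {r s : List α} (h : RowAbove r s) (hr : r.Pairwise (· < ·))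
    {x y : α} (hy : (rowInsert x r).2 = some y) :
    RowAbove (rowInsert x r).1 (rowInsert y s).1 := by
  induction r generalizing s with
  | nil => simp [rowInsert] at hy
  | cons a r ih =>
    rw [List.pairwise_cons] at hr
    rw [rowInsert] at hy ⊢
    split_ifs at hy ⊢ with hxa
    · obtain rfl : a = y := by simpa using hy
      cases s with
      | nil => exact ⟨hxa, rowAbove_nil _⟩
      | cons b s =>
        rw [rowInsert, if_pos h.1]
        exact ⟨hxa, h.2⟩
    · have hay : a < y := hr.1 y (rowInsert_snd_mem hy)
      cases s with
      | nil => exact ⟨hay, rowAbove_nil _⟩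
      | cons b s =>
        rw [rowInsert]
        split_ifs with hyb
        · exact ⟨hay, h.2.rowInsert_left x⟩
        · exact ⟨h.1, ih h.2 hr.2 hy⟩

/-- Tableaux with strictly increasing rows and columns. -/
structure IsTableau (T : Filling α) : Prop where
  ne_nil : ∀ r ∈ T, r ≠ []
  rows : ∀ r ∈ T, r.Pairwise (· < ·)
  columns : T.Pairwise RowAbove

/-- The reading word of a filling: its rows from bottom to top. -/
def readingWord {α : Type*} : Filling α → List α
  | [] => []
  | r :: T => readingWord T ++ r

theorem IsTableau.nil : IsTableau ([] : Filling α) :=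
  ⟨by simp, by simp, by simp⟩

theorem isTableau_cons {r : List α} {T : Filling α} : IsTableau (r :: T) ↔
    r ≠ [] ∧ r.Pairwise (· < ·) ∧ (∀ s ∈ T, RowAbove r s) ∧ IsTableau T := by
  constructor
  · rintro ⟨h1, h2, h3⟩
    rw [List.forall_mem_cons] at h1 h2
    rw [List.pairwise_cons] at h3
    exact ⟨h1.1, h2.1, h3.1, h1.2, h2.2, h3.2⟩
  · rintro ⟨h1, h2, h3, h4⟩
    exact ⟨List.forall_mem_cons.2 ⟨h1, h4.1⟩, List.forall_mem_cons.2 ⟨h2, h4.2⟩,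
      List.pairwise_cons.2 ⟨h3, h4.3⟩⟩

theorem schenstedInsert_cons_none {x : α} {r : List α} (T : Filling α)
    (h : (rowInsert x r).2 = none) :
    schenstedInsert x (r :: T) = ((rowInsert x r).1 :: T, 0) := by
  rw [schenstedInsert]
  split <;> simp_all

theorem schenstedInsert_cons_some {x y : α} {r : List α} (T : Filling α)
    (h : (rowInsert x r).2 = some y) :
    schenstedInsert x (r :: T) =
      ((rowInsert x r).1 :: (schenstedInsert y T).1, (schenstedInsert y T).2 + 1) := by
  rw [schenstedInsert]
  split <;> simp_all

theorem rowInsert_fst_ne_nil (x : α) (r : List α) : (rowInsert x r).1 ≠ [] := by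
  cases r with
  | nil => simp [rowInsert]
  | cons a r =>
    rw [rowInsert]
    split_ifs <;> simp

theorem readingWord_schenstedInsert_perm (x : α) (T : Filling α) :
    (readingWord (schenstedInsert x T).1).Perm (x :: readingWord T) := by
  induction T generalizing x with
  | nil => simp [schenstedInsert, readingWord]
  | cons r T ih =>
    have hp := rowInsert_perm x r
    rcases h : (rowInsert x r).2 with _ | y
    · rw [schenstedInsert_cons_none T h]
      rw [h] at hp
      exact (List.Perm.append_left _ hp).trans List.perm_middle
    · rw [schenstedInsert_cons_some T h]
      rw [h] at hp
      refine ((ih y).append_right _).trans ?_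
      refine (List.perm_middle (a := y)).symm.trans ?_
      exact (List.Perm.append_left _ hp).trans List.perm_middle

/-- The head of a tableau dominates all of its rows as soon as it dominates the second one. -/
theorem IsTableau.forall_rowAbove {r : List α} {T : Filling α} (hT : IsTableau T)
    (h : ∀ s ∈ T.head?, RowAbove r s) : ∀ s ∈ T, RowAbove r s := by
  cases T with
  | nil => simp
  | cons s T =>
    have hs : RowAbove r s := h s rfl
    exact List.forall_mem_cons.2 ⟨hs, fun t ht => hs.trans ((isTableau_cons.1 hT).2.2.1 t ht)⟩

/-- The default `[]` treats an empty tableau as having an empty first row, so that the creation of a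
new last row is no special case. -/
theorem head_schenstedInsert (x : α) (T : Filling α) :
    (schenstedInsert x T).1.head? = some (rowInsert x (T.head?.getD [])).1 := by
  cases T with
  | nil => simp [schenstedInsert, rowInsert]
  | cons r T =>
    rcases h : (rowInsert x r).2 with _ | y
    · simp [schenstedInsert_cons_none T h]
    · simp [schenstedInsert_cons_some T h]

theorem IsTableau.schenstedInsert {T : Filling α} (hT : IsTableau T) {x : α}
    (hx : (x :: readingWord T).Nodup) : IsTableau (schenstedInsert x T).1 := by
  induction T generalizing x with
  | nil => simp [RobinsonSchensted.schenstedInsert, isTableau_cons, IsTableau.nil]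
  | cons r T ih =>
    obtain ⟨h1, h2, h3, h4⟩ := isTableau_cons.1 hT
    simp only [readingWord, List.nodup_cons, List.mem_append, not_or] at hx
    obtain ⟨⟨-, hxr⟩, hnd⟩ := hx
    have hr := rowInsert_pairwise h2 hxr
    rcases h : (rowInsert x r).2 with _ | y
    · rw [schenstedInsert_cons_none T h]
      exact isTableau_cons.2 ⟨rowInsert_fst_ne_nil x r, hr,
        fun s hs => (h3 s hs).rowInsert_left x, h4⟩
    · rw [schenstedInsert_cons_some T h]
      have hy := rowInsert_snd_mem h
      rw [List.nodup_append] at hnd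
      have hyT : (y :: readingWord T).Nodup :=
        List.nodup_cons.2 ⟨fun hyT => hnd.2.2 y hyT y hy rfl, hnd.1⟩
      refine isTableau_cons.2 ⟨rowInsert_fst_ne_nil x r, hr, ?_, ih h4 hyT⟩
      refine (ih h4 hyT).forall_rowAbove ?_
      rw [head_schenstedInsert]
      rintro s ⟨⟩
      refine RowAbove.rowInsert_rowInsert ?_ h2 h
      cases T with
      | nil => simp
      | cons s T => exact h3 s (by simp)

/-- Let T' be `T` after inserting the bumped `y`, and r' the new first row. Induction on the lower
rows turns T' r' into T y r', and the row lemma turns y r' into r x. -/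
theorem knuthMoves_schenstedInsert {T : Filling α} (hT : IsTableau T) {x : α}
    (hx : (x :: readingWord T).Nodup) :
    ReflTransGen KnuthMove (readingWord (schenstedInsert x T).1) (readingWord T ++ [x]) := by
  induction T generalizing x with
  | nil => exact .refl
  | cons r T ih =>
    obtain ⟨h1, h2, h3, h4⟩ := isTableau_cons.1 hT
    simp only [readingWord, List.nodup_cons, List.mem_append, not_or] at hx
    obtain ⟨⟨-, hxr⟩, hnd⟩ := hx
    rcases h : (rowInsert x r).2 with _ | y
    · rw [schenstedInsert_cons_none T h]
      simp only [readingWord, rowInsert_fst_of_snd_eq_none h, List.append_assoc]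
      exact .refl
    · rw [schenstedInsert_cons_some T h]
      have hy := rowInsert_snd_mem h
      rw [List.nodup_append] at hnd
      have hyT : (y :: readingWord T).Nodup :=
        List.nodup_cons.2 ⟨fun hyT => hnd.2.2 y hyT y hy rfl, hnd.1⟩
      have h5 := knuthMoves_append_append (ih h4 hyT) [] (rowInsert x r).1
      have h6 := knuthMoves_append_append (knuthMoves_rowInsert h2 hxr h) (readingWord T) []
      simp only [List.nil_append, List.append_nil, List.append_assoc, List.cons_append,
        readingWord] at h5 h6 ⊢
      exact h5.trans h6

/-- The insertion tableau of a word, starting from the tableau `T`. -/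
def insertWord (T : Filling α) (w : List α) : Filling α :=
  w.foldl (fun T x => (schenstedInsert x T).1) T

theorem insertWord_spec {T : Filling α} (hT : IsTableau T) {w : List α}
    (hw : (readingWord T ++ w).Nodup) :
    IsTableau (insertWord T w) ∧
      ReflTransGen KnuthMove (readingWord (insertWord T w)) (readingWord T ++ w) ∧
      (readingWord (insertWord T w)).Perm (readingWord T ++ w) := by
  induction w generalizing T with
  | nil => simpa [insertWord] using ⟨hT, .refl⟩
  | cons x w ih =>
    have hp : (readingWord (schenstedInsert x T).1 ++ w).Perm (readingWord T ++ x :: w) :=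
      ((readingWord_schenstedInsert_perm x T).append_right w).trans List.perm_middle.symm
    have hx : (x :: readingWord T).Nodup := by
      have := List.perm_middle.nodup_iff.1 hw
      exact this.sublist (by simp)
    obtain ⟨h1, h2, h3⟩ := ih (hT.schenstedInsert hx) (hp.nodup_iff.2 hw)
    refine ⟨h1, h2.trans ?_, h3.trans hp⟩
    simpa using knuthMoves_append_append (knuthMoves_schenstedInsert hT hx) [] w

/-! ## Covers of the reading word of a tableau -/

/-- Each letter is coloured by the index of its row. -/
theorem IsTableau.hasIncreasingCover {T : Filling α} (hT : IsTableau T) (k : ℕ) :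
    HasIncreasingCover k ((T.map List.length).take k).sum (readingWord T) := by
  -- For the induction, row indices start at `i`; the bound `i ≤ p.2` keeps the colours of lower
  -- rows apart from that of the head. Truncation of `k - i` discards the rows from index `k` on.
  suffices h : ∀ i, ∃ d : List (α × ℕ), d.map Prod.fst = readingWord T ∧
      d.Pairwise (fun p q => p.2 = q.2 → p.2 < k → p.1 < q.1) ∧ (∀ p ∈ d, i ≤ p.2) ∧
      ((T.map List.length).take (k - i)).sum = d.countP (fun p => p.2 < k) by
    obtain ⟨d, h1, h2, -, h3⟩ := h 0
    exact ⟨d, h1, h2, h3.le⟩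
  induction T with
  | nil => exact fun i => ⟨[], by simp [readingWord]⟩
  | cons r T ih =>
    intro i
    obtain ⟨h1, h2, h3, h4⟩ := isTableau_cons.1 hT
    obtain ⟨d, hd, hp, hi, hs⟩ := ih h4 (i + 1)
    refine ⟨d ++ r.map (fun a => (a, i)), by simp [readingWord, hd, Function.comp_def], ?_, ?_, ?_⟩
    · refine List.pairwise_append.2 ⟨hp, ?_, ?_⟩
      · exact List.pairwise_map.2 (h2.imp fun h _ _ => h)
      · simp only [List.forall_mem_map]
        intro p hp a _ h
        exact absurd (hi p hp) (by omega)
    · simp only [List.mem_append, List.mem_map]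
      rintro p (hp | ⟨a, -, rfl⟩)
      · exact (Nat.le_succ i).trans (hi p hp)
      · exact le_rfl
    · rw [List.countP_append, ← hs, List.countP_map]
      by_cases hik : i < k
      · obtain ⟨c, rfl⟩ := Nat.exists_eq_add_of_lt hik
        simp [show i + c + 1 - i = c + 1 by omega, show i + c + 1 - (i + 1) = c by omega,
          Function.comp_def, add_comm]
      · simp [show k - i = 0 by omega, show k - (i + 1) = 0 by omega, Function.comp_def, hik]

theorem countP_zipIdx_lt {β : Type*} (r : List β) (k i : ℕ) :
    (r.zipIdx i).countP (fun p => p.2 < k) = min r.length (k - i) := by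
  induction r generalizing i with
  | nil => simp
  | cons a r ih =>
    simp only [List.zipIdx_cons, List.countP_cons, ih, List.length_cons, decide_eq_true_eq]
    split_ifs <;> omega

theorem readingWord_reverse {β : Type*} (T : Filling β) :
    (readingWord T).reverse = (T.map List.reverse).flatten := by
  induction T with
  | nil => rfl
  | cons r T ih => simp [readingWord, ih]

/-- Each letter is coloured by the index of its column. The reversed word reads the rows from top to
bottom, so equal colours increase; within one row all colours differ. -/
theorem IsTableau.hasIncreasingCover_reverse {T : Filling α} (hT : IsTableau T) (k : ℕ) :
    HasIncreasingCover k ((T.map List.length).map (min · k)).sum (readingWord T).reverse := by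
  refine ⟨(T.map fun r => r.zipIdx.reverse).flatten, ?_, ?_, ?_⟩
  · simp [readingWord_reverse, List.map_flatten, Function.comp_def]
  · refine List.pairwise_flatten.2 ⟨?_, ?_⟩
    · simp only [List.forall_mem_map]
      intro r _
      rw [List.pairwise_reverse]
      have h : (r.zipIdx.map Prod.snd).Pairwise (· ≠ ·) := by
        rw [List.zipIdx_map_snd]
        exact List.nodup_range'
      exact (List.pairwise_map.1 h).imp fun h h' => (h h'.symm).elim
    · refine List.pairwise_map.2 (hT.columns.imp ?_)
      rintro r s hrs ⟨a, i⟩ ha ⟨b, j⟩ hb hij -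
      simp only at hij
      subst hij
      rw [List.mem_reverse, List.mem_zipIdx_iff_getElem?] at ha hb
      exact hrs.getElem_lt ha hb
  · rw [List.countP_flatten]
    simp [Function.comp_def, countP_zipIdx_lt]

/-! ## Chains and antichains of the permutation poset -/

/-- As `L` has no repetitions, a colouring of positions is a function of the index. -/
theorem HasIncreasingCover.exists_coloring {ι : Type*} {k m : ℕ} {L : List ι}
    (hL : L.Nodup) {f : ι → α} (h : HasIncreasingCover k m (L.map f)) :
    ∃ c : ι → ℕ, L.Pairwise (fun i j => c i = c j → c i < k → f i < f j) ∧
      m ≤ L.countP (fun i => c i < k) := by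
  classical
  obtain ⟨d, hd, hp, hm⟩ := h
  suffices h : ∃ c : ι → ℕ, d = L.map fun i => (f i, c i) by
    obtain ⟨c, rfl⟩ := h
    rw [List.countP_map] at hm
    exact ⟨c, List.pairwise_map.1 hp, hm⟩
  clear hp hm
  induction L generalizing d with
  | nil => exact ⟨fun _ => 0, by simpa using hd⟩
  | cons i L ih =>
    obtain ⟨⟨a, t⟩, d', rfl, rfl, hd'⟩ := List.map_eq_cons_iff.1 hd
    rw [List.nodup_cons] at hL
    obtain ⟨c, rfl⟩ := ih hL.2 d' hd'
    refine ⟨Function.update c i t, ?_⟩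
    simp only [List.map_cons, Function.update_self, List.cons.injEq, true_and]
    refine List.map_congr_left fun j hj => ?_
    rw [Function.update_of_ne (by rintro rfl; exact hL.1 hj)]

/-- The elements of a permutation poset are numbered by their first coordinates. -/
def permPosetEquiv {n : ℕ} (σ : Equiv.Perm (Fin n)) : Fin n ≃ PermPoset σ where
  toFun i := ⟨(i, σ i), rfl⟩
  invFun p := p.1.1
  left_inv _ := rfl
  right_inv := by
    rintro ⟨⟨i, j⟩, h⟩
    simp only at h
    subst h
    rfl

theorem card_permPoset {n : ℕ} (σ : Equiv.Perm (Fin n)) : Nat.card (PermPoset σ) = n := by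
  rw [← Nat.card_congr (permPosetEquiv σ), Nat.card_fin]

theorem le_ncard_iUnion_coloring {n m k : ℕ} (σ : Equiv.Perm (Fin n)) {c : Fin n → ℕ}
    {L : List (Fin n)} (hL : L.Nodup) (hm : m ≤ L.countP (fun i => c i < k)) :
    m ≤ (⋃ t : Fin k, {p : PermPoset σ | c p.1.1 = t}).ncard := by
  refine hm.trans ?_
  have h : (⋃ t : Fin k, {p : PermPoset σ | c p.1.1 = t}) =
      permPosetEquiv σ '' {i | c i < k} := by
    ext p
    rw [Equiv.image_eq_preimage_symm]
    simp only [Set.mem_iUnion, Set.mem_ofPred_eq, Set.mem_preimage]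
    exact ⟨fun ⟨t, ht⟩ => (show c p.1.1 < k from ht ▸ t.2), fun h => ⟨⟨_, h⟩, rfl⟩⟩
  rw [h, Set.ncard_image_of_injective _ (permPosetEquiv σ).injective, List.countP_eq_length_filter,
    ← List.toFinset_card_of_nodup (hL.filter _), ← Set.ncard_coe_finset]
  exact Set.ncard_le_ncard fun i => by simp

theorem le_maxChainUnion_of_cover {n m k : ℕ} (σ : Equiv.Perm (Fin n))
    (h : HasIncreasingCover k m ((List.finRange n).map σ)) :
    m ≤ maxChainUnion (PermPoset σ) k := by
  obtain ⟨c, hc, hm⟩ := h.exists_coloring (List.nodup_finRange n)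
  refine (le_ncard_iUnion_coloring σ (List.nodup_finRange n) hm).trans
    ((isGreatest_maxChainUnion (PermPoset σ) k).2 ⟨_, fun t => ?_, rfl⟩)
  have hlt : ∀ i j, i < j → c i = c j → c i < k → σ i < σ j := fun i j hij => by
    simpa using List.pairwise_iff_getElem.1 hc i j (by simp) (by simp) hij
  intro p hp q hq _
  obtain ⟨i, rfl⟩ := (permPosetEquiv σ).surjective p
  obtain ⟨j, rfl⟩ := (permPosetEquiv σ).surjective q
  have hi : c i = t := hp
  have hj : c j = t := hq
  rcases lt_trichotomy i j with hij | rfl | hij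
  · exact Or.inl ⟨hij.le, (hlt i j hij (hi.trans hj.symm) (hi ▸ t.2)).le⟩
  · exact Or.inl le_rfl
  · exact Or.inr ⟨hij.le, (hlt j i hij (hj.trans hi.symm) (hj ▸ t.2)).le⟩

/-- A subword increasing in the reversed word is decreasing in the word itself, so its points are
pairwise incomparable. -/
theorem le_maxAntichainUnion_of_cover {n m k : ℕ} (σ : Equiv.Perm (Fin n))
    (h : HasIncreasingCover k m ((List.finRange n).map σ).reverse) :
    m ≤ maxAntichainUnion (PermPoset σ) k := by
  rw [← List.map_reverse] at h
  have hnd : (List.finRange n).reverse.Nodup := List.nodup_reverse.2 (List.nodup_finRange n)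
  obtain ⟨c, hc, hm⟩ := h.exists_coloring hnd
  refine (le_ncard_iUnion_coloring σ hnd hm).trans
    ((isGreatest_maxAntichainUnion (PermPoset σ) k).2 ⟨_, fun t => ?_, rfl⟩)
  rw [List.pairwise_reverse] at hc
  have hlt : ∀ i j, i < j → c j = c i → c j < k → σ j < σ i := fun i j hij => by
    simpa using List.pairwise_iff_getElem.1 hc i j (by simp) (by simp) hij
  intro p hp q hq hpq hle
  obtain ⟨i, rfl⟩ := (permPosetEquiv σ).surjective p
  obtain ⟨j, rfl⟩ := (permPosetEquiv σ).surjective q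
  have hi : c i = t := hp
  have hj : c j = t := hq
  have hij : i < j := lt_of_le_of_ne hle.1 (by rintro rfl; exact hpq rfl)
  exact (hlt i j hij (hj.trans hi.symm) (hj ▸ t.2)).not_ge hle.2

/-- Each chain meets each antichain in at most one element. -/
theorem maxChainUnion_add_maxAntichainUnion_le (P : Type*) [PartialOrder P] [Finite P]
    (k l : ℕ) : maxChainUnion P k + maxAntichainUnion P l ≤ Nat.card P + k * l := by
  obtain ⟨C, hC, hCk⟩ := (isGreatest_maxChainUnion P k).1
  obtain ⟨A, hA, hAl⟩ := (isGreatest_maxAntichainUnion P l).1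
  rw [← hCk, ← hAl, ← Set.ncard_union_add_ncard_inter]
  refine add_le_add (Set.ncard_le_card _) ?_
  have h : (⋃ t, C t) ∩ (⋃ t, A t) = ⋃ s : Fin k × Fin l, C s.1 ∩ A s.2 := by
    ext p
    simp
  rw [h]
  have hsum : (⋃ s : Fin k × Fin l, C s.1 ∩ A s.2).ncard ≤
      ∑ s : Fin k × Fin l, (C s.1 ∩ A s.2).ncard := by
    exact Set.ncard_iUnion_le_of_fintype _
  refine hsum.trans ((Finset.sum_le_card_nsmul _ _ 1 fun s _ => ?_).trans (by simp))
  refine (Set.ncard_le_one_iff (Set.toFinite _)).2 ?_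
  rintro p q ⟨hp, hp'⟩ ⟨hq, hq'⟩
  by_contra hpq
  rcases hC _ hp hq hpq with h | h
  · exact hA _ hp' hq' hpq h
  · exact hA _ hq' hp' (Ne.symm hpq) h

/-! ## Young diagrams -/

theorem card_filter_fst_lt (μ : YoungDiagram) (k : ℕ) :
    (μ.cells.filter fun c => c.1 < k).card = ∑ i ∈ Finset.range k, μ.rowLen i := by
  rw [Finset.card_eq_sum_card_fiberwise (f := Prod.fst) (t := Finset.range k)]
  · refine Finset.sum_congr rfl fun i hi => ?_
    rw [YoungDiagram.rowLen_eq_card, YoungDiagram.row, Finset.filter_filter]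
    congr 1
    refine Finset.filter_congr fun c _ => ?_
    rw [Finset.mem_range] at hi
    constructor
    · exact fun h => h.2
    · rintro rfl
      exact ⟨hi, rfl⟩
  · intro c hc
    simpa using (Finset.mem_filter.1 hc).2

theorem card_filter_snd_lt (μ : YoungDiagram) (l : ℕ) :
    (μ.cells.filter fun c => c.2 < l).card = ∑ j ∈ Finset.range l, μ.colLen j := by
  rw [Finset.card_eq_sum_card_fiberwise (f := Prod.snd) (t := Finset.range l)]
  · refine Finset.sum_congr rfl fun i hi => ?_
    rw [YoungDiagram.colLen_eq_card, YoungDiagram.col, Finset.filter_filter]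
    congr 1
    refine Finset.filter_congr fun c _ => ?_
    rw [Finset.mem_range] at hi
    constructor
    · exact fun h => h.2
    · rintro rfl
      exact ⟨hi, rfl⟩
  · intro c hc
    simpa using (Finset.mem_filter.1 hc).2

/-- Inclusion–exclusion: the first `k` rows and first `l` columns cover `μ`, and their intersection
is the full rectangle. -/
theorem sum_rowLen_add_sum_colLen {μ : YoungDiagram} {k l : ℕ}
    (h1 : ∀ c ∈ μ, c.1 < k ∨ c.2 < l) (h2 : ∀ i < k, ∀ j < l, (i, j) ∈ μ) :
    ∑ i ∈ Finset.range k, μ.rowLen i + ∑ j ∈ Finset.range l, μ.colLen j = μ.card + k * l := by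
  rw [← card_filter_fst_lt, ← card_filter_snd_lt, ← Finset.card_union_add_card_inter,
    ← Finset.filter_or, ← Finset.filter_and]
  congr 1
  · rw [Finset.filter_true_of_mem fun c hc => h1 c hc]
  · rw [← Finset.card_range k, ← Finset.card_range l, ← Finset.card_product]
    simp only [Finset.card_range]
    congr 1
    ext ⟨i, j⟩
    simp only [Finset.mem_filter, YoungDiagram.mem_cells, Finset.mem_product, Finset.mem_range]
    exact ⟨fun h => h.2, fun h => ⟨h2 i h.1 j h.2, h⟩⟩

theorem sum_rowLen_add_sum_colLen_rowLen (μ : YoungDiagram) (k : ℕ) :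
    ∑ i ∈ Finset.range k, μ.rowLen i + ∑ j ∈ Finset.range (μ.rowLen k), μ.colLen j =
      μ.card + k * μ.rowLen k := by
  refine sum_rowLen_add_sum_colLen ?_ fun i hi j hj => ?_
  · rintro ⟨i, j⟩ h
    by_contra! hc
    have h1 := μ.rowLen_anti k i hc.1
    have h2 := YoungDiagram.mem_iff_lt_rowLen.1 h
    simp only at hc
    omega
  · exact YoungDiagram.mem_iff_lt_rowLen.2 (hj.trans_le (μ.rowLen_anti i k hi.le))

theorem sum_rowLen_colLen_add_sum_colLen (μ : YoungDiagram) (l : ℕ) :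
    ∑ i ∈ Finset.range (μ.colLen l), μ.rowLen i + ∑ j ∈ Finset.range l, μ.colLen j =
      μ.card + μ.colLen l * l := by
  refine sum_rowLen_add_sum_colLen ?_ fun i hi j hj => ?_
  · rintro ⟨i, j⟩ h
    by_contra! hc
    have h1 := μ.colLen_anti l j hc.2
    have h2 := YoungDiagram.mem_iff_lt_colLen.1 h
    simp only at hc
    omega
  · exact YoungDiagram.mem_iff_lt_colLen.2 (hi.trans_le (μ.colLen_anti j l hj.le))

theorem sum_map_range (f : ℕ → ℕ) (m : ℕ) :
    ((List.range m).map f).sum = ∑ i ∈ Finset.range m, f i := rfl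

theorem sum_take_rowLens (μ : YoungDiagram) (k : ℕ) :
    (μ.rowLens.take k).sum = ∑ i ∈ Finset.range k, μ.rowLen i := by
  -- `rowLens` stops at the last nonzero row, so for larger `k` the extra terms on the right must
  -- vanish.
  have h0 : ∀ i, μ.colLen 0 ≤ i → μ.rowLen i = 0 := by
    intro i hi
    by_contra h
    have h1 : (i, 0) ∈ μ := YoungDiagram.mem_iff_lt_rowLen.2 (Nat.pos_of_ne_zero h)
    exact hi.not_gt (YoungDiagram.mem_iff_lt_colLen.1 h1)
  rw [YoungDiagram.rowLens, ← List.map_take, List.take_range, sum_map_range]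
  refine Finset.sum_subset (by simp) fun i hi hi' => h0 i ?_
  simp only [Finset.mem_range] at hi hi'
  omega

/-- Double counting of the cells in the first `l` columns, by rows and by columns. -/
theorem sum_map_min_rowLens (μ : YoungDiagram) (l : ℕ) :
    (μ.rowLens.map (min · l)).sum = ∑ j ∈ Finset.range l, μ.colLen j := by
  rw [← card_filter_snd_lt, Finset.card_eq_sum_card_fiberwise (f := Prod.fst)
    (t := Finset.range (μ.colLen 0))]
  · rw [YoungDiagram.rowLens, List.map_map, sum_map_range]
    refine Finset.sum_congr rfl fun i _ => ?_
    rw [← Finset.card_range (((min · l) ∘ μ.rowLen) i)]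
    refine Finset.card_bij (fun j _ => (i, j)) ?_ ?_ ?_
    · intro j hj
      simp at hj
      simpa [YoungDiagram.mem_iff_lt_rowLen] using hj
    · simp
    · rintro ⟨i', j⟩ h
      simp only [Finset.mem_filter, YoungDiagram.mem_cells, YoungDiagram.mem_iff_lt_rowLen] at h
      obtain ⟨h, rfl⟩ := h
      exact ⟨j, by simpa using h, rfl⟩
  · rintro ⟨i, j⟩ h
    simp only [Finset.coe_filter, Set.mem_ofPred_eq, YoungDiagram.mem_cells] at h
    simpa using YoungDiagram.mem_iff_lt_colLen.1 (μ.up_left_mem le_rfl (Nat.zero_le j) h.1)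

theorem sum_rowLens (μ : YoungDiagram) : μ.rowLens.sum = μ.card := by
  have h := sum_take_rowLens μ (μ.colLen 0)
  rw [List.take_of_length_le (by simp), ← card_filter_fst_lt, Finset.filter_true_of_mem] at h
  · exact h
  · rintro ⟨i, j⟩ h
    exact YoungDiagram.mem_iff_lt_colLen.1 (μ.up_left_mem le_rfl (Nat.zero_le j) h)

theorem IsTableau.exists_hasShape {T : Filling α} (hT : IsTableau T) :
    ∃ μ : YoungDiagram, HasShape T μ := by
  refine ⟨YoungDiagram.ofRowLens (T.map List.length) ?_, ?_⟩
  · exact (List.pairwise_map.2 (hT.columns.imp fun h => h.length_le)).sortedGE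
  · refine (YoungDiagram.rowLens_ofRowLens_eq_self ?_).symm
    simp only [List.forall_mem_map]
    exact fun r hr => List.length_pos_of_ne_nil (hT.ne_nil r hr)

theorem length_readingWord {β : Type*} (T : Filling β) :
    (readingWord T).length = (T.map List.length).sum := by
  induction T with
  | nil => rfl
  | cons r T ih => simp [readingWord, ih, add_comm]

/-! ## The shape of the recording tableau -/

/-- Add a box to the row with index `k` of a shape given by the list of its row lengths. -/
def addBoxLengths : ℕ → List ℕ → List ℕ
  | _, [] => [1]
  | 0, l :: L => (l + 1) :: L
  | k + 1, l :: L => l :: addBoxLengths k L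

theorem map_length_addBox {β : Type*} (a : β) (k : ℕ) (T : Filling β) :
    (addBox a k T).map List.length = addBoxLengths k (T.map List.length) := by
  induction T generalizing k with
  | nil => cases k <;> rfl
  | cons r T ih => cases k <;> simp [addBox, addBoxLengths, ih]

/-- A bump leaves the length of its row unchanged, so only the row where the insertion stops grows.
-/
theorem map_length_schenstedInsert (x : α) (T : Filling α) :
    (schenstedInsert x T).1.map List.length =
      addBoxLengths (schenstedInsert x T).2 (T.map List.length) := by
  induction T generalizing x with
  | nil => rfl
  | cons r T ih =>
    rcases h : (rowInsert x r).2 with _ | y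
    · simp [schenstedInsert_cons_none T h, addBoxLengths, rowInsert_fst_of_snd_eq_none h]
    · have hl : (rowInsert x r).1.length = r.length := by
        simpa [h] using (rowInsert_perm x r).length_eq
      simp [schenstedInsert_cons_some T h, addBoxLengths, ih, hl]

theorem map_length_foldl_rsStep {n : ℕ} (σ : Equiv.Perm (Fin n)) (L : List (Fin n))
    (s : Filling (Fin n) × Filling (Fin n))
    (hs : s.2.map List.length = s.1.map List.length) :
    (L.foldl (rsStep σ) s).2.map List.length = (L.foldl (rsStep σ) s).1.map List.length := by
  induction L generalizing s with
  | nil => exact hs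
  | cons i L ih =>
    refine ih _ ?_
    rw [rsStep, map_length_addBox, map_length_schenstedInsert, hs]

theorem foldl_rsStep_fst {n : ℕ} (σ : Equiv.Perm (Fin n)) (L : List (Fin n))
    (s : Filling (Fin n) × Filling (Fin n)) :
    (L.foldl (rsStep σ) s).1 = insertWord s.1 (L.map σ) := by
  induction L generalizing s with
  | nil => rfl
  | cons i L ih => exact ih _

end RobinsonSchensted

open RobinsonSchensted

theorem theorem3p2 (n : ℕ) (σ : Equiv.Perm (Fin n)) :
    ∃ μ : YoungDiagram,
      RobinsonSchensted.HasShape (RobinsonSchensted.insertionTableau σ) μ ∧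
      RobinsonSchensted.HasShape (RobinsonSchensted.recordingTableau σ) μ ∧
      RobinsonSchensted.IsPosetShape (RobinsonSchensted.PermPoset σ) μ := by
  have hP : insertionTableau σ = insertWord [] ((List.finRange n).map σ) :=
    foldl_rsStep_fst σ _ _
  obtain ⟨hT, hmoves, hperm⟩ := insertWord_spec (w := (List.finRange n).map σ) IsTableau.nil
    ((List.nodup_finRange n).map σ.injective)
  rw [← hP] at hT hmoves hperm
  obtain ⟨μ, hμ⟩ := hT.exists_hasShape
  have hcard : μ.card = Nat.card (PermPoset σ) := by
    rw [card_permPoset, ← sum_rowLens, ← hμ, ← length_readingWord, hperm.length_eq]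
    simp [readingWord]
  have hc : ∀ k, ∑ i ∈ Finset.range k, μ.rowLen i ≤ maxChainUnion (PermPoset σ) k := by
    intro k
    rw [← sum_take_rowLens, ← hμ]
    exact le_maxChainUnion_of_cover σ ((hT.hasIncreasingCover k).of_knuthMoves hmoves)
  have ha : ∀ l, ∑ j ∈ Finset.range l, μ.colLen j ≤ maxAntichainUnion (PermPoset σ) l := by
    intro l
    rw [← sum_map_min_rowLens, ← hμ]
    exact le_maxAntichainUnion_of_cover σ
      ((hT.hasIncreasingCover_reverse l).reverse_of_knuthMoves hmoves)
  have hca : ∀ k l, maxChainUnion (PermPoset σ) k + maxAntichainUnion (PermPoset σ) l ≤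
      μ.card + k * l := by
    intro k l
    rw [hcard]
    exact maxChainUnion_add_maxAntichainUnion_le (PermPoset σ) k l
  -- With l = `μ.rowLen k` the duality bound is tight, so the lower bound on a_l becomes an upper
  -- bound on c_k.
  have hc' : ∀ k, maxChainUnion (PermPoset σ) k = ∑ i ∈ Finset.range k, μ.rowLen i := by
    intro k
    have h1 := hca k (μ.rowLen k)
    have h2 := ha (μ.rowLen k)
    have h3 := sum_rowLen_add_sum_colLen_rowLen μ k
    exact le_antisymm (by omega) (hc k)
  have ha' : ∀ l, maxAntichainUnion (PermPoset σ) l = ∑ j ∈ Finset.range l, μ.colLen j := by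
    intro l
    have h1 := hca (μ.colLen l) l
    have h2 := hc (μ.colLen l)
    have h3 := sum_rowLen_colLen_add_sum_colLen μ l
    exact le_antisymm (by omega) (ha l)
  refine ⟨μ, hμ, (map_length_foldl_rsStep σ _ _ rfl).trans hμ, fun k => ?_, fun l => ?_⟩
  · rw [hc', hc', Finset.sum_range_succ]
  · rw [ha', ha', Finset.sum_range_succ]
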